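/- A finite poset $\mathcal S$ is called simplicial if it has a least element $\hat 0$ and for every $\sigma\in\mathcal S$ the segment $[\hat 0,\sigma]$ is isomorphic to the poset of all subsets of a finite set; the vertices of $\mathcal S$ are its elements of rank one, that is, its minimal elements other than $\hat 0$. Let $V$ be the vertex set and $m=|V|$. The geometric realisation $|\mathcal S|$ is the colimit, in topological spaces, over $\sigma\in\mathcal S$ of the simplices $\Delta^\sigma$ with vertex set $\{i\in V : i\le\sigma\}$ (so $\Delta^{\hat 0}=\varnothing$) and the inclusions of faces $\Delta^\tau\subset\Delta^\sigma$ for $\tau\le\sigma$. The moment-angle complex $\mathcal Z_{\mathcal S}$ is the colimit, in topological spaces, over $\sigma\in\mathcal S$ of the spaces $$B_\sigma=\{z\in\mathbb C^V : |z_i|\le 1 \text{ for all } i,\ |z_j|=1 \text{ whenever } j\not\le\sigma\}$$ and the inclusions $B_\tau\subset B_\sigma$ for $\tau\le\sigma$. The torus $T^m=(S^1)^V$ acts on $\mathcal Z_{\mathcal S}$ through coordinatewise multiplication. The join $\mathcal S_1*\mathcal S_2$ is the set of pairs $(\sigma_1,\sigma_2)$, $\sigma_i\in\mathcal S_i$,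 with the componentwise order; it is again a simplicial poset. **Proposition.** Let $\mathcal S$, $\mathcal S_1$, $\mathcal S_2$ be finite simplicial posets, and let $m$ be the number of vertices of $\mathcal S$. (a) $\mathcal Z_{\mathcal S_1*\mathcal S_2}$ is homeomorphic to $\mathcal Z_{\mathcal S_1}\times\mathcal Z_{\mathcal S_2}$. (b) The orbit space $\mathcal Z_{\mathcal S}/T^m$ is homeomorphic to the cone over $|\mathcal S|$ (the cone over the empty space being a point). (c) If $n\ge 0$ and $|\mathcal S|$ is homeomorphic to the sphere $S^{n-1}$ (with $S^{-1}=\varnothing$), then $\mathcal Z_{\mathcal S}$ is a topological manifold (Hausdorff, second countable, locally homeomorphic to $\mathbb R^{m+n}$) of dimension $m+n$. -/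

import Mathlib

/-! ### Simplicial posets -/

/-- A poset with an initial element `⊥` is *simplicial* if each lower segment `[⊥, σ]` is a
boolean lattice, i.e. is isomorphic to the poset of subsets of a finite set. (Finiteness of the
whole poset is the separate hypothesis `[Finite S]`.) -/
class IsSimplicialPoset (S : Type*) [PartialOrder S] [OrderBot S] : Prop where
  boolean_Iic : ∀ σ : S, ∃ k : ℕ, Nonempty (Set.Iic σ ≃o Finset (Fin k))

namespace SimplicialPoset

/-- The vertices of `S`: the minimal elements of `S \ {⊥}`, that is, the elements of rank one
(see `isAtom_iff_rank_one`). -/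
def Vertex (S : Type*) [PartialOrder S] [OrderBot S] : Type _ := {v : S // IsAtom v}

/-- An element is an atom iff it has rank one, i.e. its lower segment is the face poset of a
point. -/
theorem isAtom_iff_rank_one {S : Type*} [PartialOrder S] [OrderBot S] [IsSimplicialPoset S]
    (v : S) : IsAtom v ↔ Nonempty (Set.Iic v ≃o Finset (Fin 1)) := by
  have key : ∀ {k : ℕ} (e : Set.Iic v ≃o Finset (Fin k)), IsAtom v ↔ k = 1 := by
    intro k e
    have h1 : IsAtom v ↔ IsAtom (⊤ : Set.Iic v) := by
      constructor
      · intro h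
        refine ⟨fun h' => h.1 (congrArg Subtype.val h'), fun b hb => Subtype.ext (h.2 b.1 hb)⟩
      · intro h
        refine ⟨fun h' => h.1 (Subtype.ext h'), fun b hb => ?_⟩
        exact congrArg Subtype.val (h.2 ⟨b, hb.le⟩ hb)
    rw [h1, ← e.isAtom_iff, map_top, Finset.isAtom_iff]
    constructor
    · rintro ⟨a, ha⟩
      have := congrArg Finset.card ha
      simpa using this
    · rintro rfl
      exact ⟨0, by ext x; simp [Subsingleton.elim x 0]⟩
  constructor
  · intro h
    obtain ⟨k, ⟨e⟩⟩ := IsSimplicialPoset.boolean_Iic v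
    obtain rfl := (key e).1 h
    exact ⟨e⟩
  · rintro ⟨e⟩
    exact (key e).2 rfl

instance instFiniteVertex (S : Type*) [PartialOrder S] [OrderBot S] [Finite S] :
    Finite (Vertex S) :=
  inferInstanceAs (Finite {v : S // IsAtom v})

noncomputable instance instFintypeVertex (S : Type*) [PartialOrder S] [OrderBot S] [Finite S] :
    Fintype (Vertex S) :=
  Fintype.ofFinite _

/-- The join `S₁ * S₂`: pairs `(σ₁, σ₂)`, with the componentwise order. -/
abbrev Join (S₁ S₂ : Type*) : Type _ := S₁ × S₂

/-- The join of two simplicial posets is a simplicial poset. -/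
instance instIsSimplicialPosetJoin (S₁ S₂ : Type*) [PartialOrder S₁] [OrderBot S₁]
    [PartialOrder S₂] [OrderBot S₂] [IsSimplicialPoset S₁] [IsSimplicialPoset S₂] :
    IsSimplicialPoset (Join S₁ S₂) where
  boolean_Iic := by
    rintro ⟨a, b⟩
    obtain ⟨k, ⟨e⟩⟩ := IsSimplicialPoset.boolean_Iic a
    obtain ⟨l, ⟨f⟩⟩ := IsSimplicialPoset.boolean_Iic b
    let g₁ : Set.Iic (a, b) ≃o Set.Iic a × Set.Iic b :=
      { toFun := fun p => (⟨p.1.1, p.2.1⟩, ⟨p.1.2, p.2.2⟩)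
        invFun := fun q => ⟨(q.1.1, q.2.1), ⟨q.1.2, q.2.2⟩⟩
        left_inv := fun _ => rfl
        right_inv := fun _ => rfl
        map_rel_iff' := Iff.rfl }
    let g₀ : Set.Iic a × Set.Iic b ≃o Finset (Fin k) × Finset (Fin l) :=
      { toEquiv := e.toEquiv.prodCongr f.toEquiv
        map_rel_iff' := by
          rintro ⟨x, y⟩ ⟨x', y'⟩
          simp [Prod.le_def] }
    let g₂ : Finset (Fin k ⊕ Fin l) ≃o Finset (Fin (k + l)) :=
      { toEquiv := finSumFinEquiv.finsetCongr
        map_rel_iff' := by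
          intro s t
          simp }
    exact ⟨k + l, ⟨g₁.trans (g₀.trans (Finset.sumEquiv.symm.trans g₂))⟩⟩

/-! ### Gluing an increasing family of subspaces along a poset -/

/-- The colimit, in topological spaces, of the diagram `σ ↦ A σ` of subspaces of `X` and
inclusions `A τ ⊆ A σ` for `τ ≤ σ`: the disjoint union of the `A σ`, with `x ∈ A τ` identified
with its image `x ∈ A σ` whenever `τ ≤ σ`, with the quotient topology. -/
def Glue {S X : Type*} [Preorder S] (A : S → Set X) : Type _ :=
  Quot (fun p q : (Σ σ : S, A σ) => p.1 ≤ q.1 ∧ (p.2 : X) = (q.2 : X))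

instance instTopologicalSpaceGlue {S X : Type*} [Preorder S] [TopologicalSpace X]
    (A : S → Set X) : TopologicalSpace (Glue A) :=
  inferInstanceAs (TopologicalSpace (Quot _))

/-! ### The geometric realisation -/

/-- The geometric simplex `Δ^σ`, with vertex set `V(σ)`, as a face of the standard simplex on all
the vertices of `S`. It is empty for `σ = ⊥`. -/
def simplex {S : Type*} [PartialOrder S] [OrderBot S] [Finite S] (σ : S) :
    Set (Vertex S → ℝ) :=
  {x | x ∈ stdSimplex ℝ (Vertex S) ∧ ∀ j : Vertex S, ¬ j.1 ≤ σ → x j = 0}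

/-- The space `|S|`: the geometric simplices `Δ^σ` glued along the inclusions of faces. -/
abbrev Realization (S : Type*) [PartialOrder S] [OrderBot S] [Finite S] : Type _ :=
  Glue (simplex (S := S))

/-! ### The moment-angle complex and its torus action -/

/-- The block `B_σ`: points of the polydisc `(D²)^m` whose `j`-th coordinate is on the boundary
circle for every vertex `j` with `j ≰ σ`. -/
def block {S : Type*} [PartialOrder S] [OrderBot S] (σ : S) : Set (Vertex S → ℂ) :=
  {z | (∀ i, ‖z i‖ ≤ 1) ∧ ∀ j : Vertex S, ¬ j.1 ≤ σ → ‖z j‖ = 1}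

theorem simplex_mono {S : Type*} [PartialOrder S] [OrderBot S] [Finite S] :
    Monotone (simplex (S := S)) :=
  fun _ _ h _ hx => ⟨hx.1, fun j hj => hx.2 j fun hj' => hj (hj'.trans h)⟩

theorem block_mono {S : Type*} [PartialOrder S] [OrderBot S] : Monotone (block (S := S)) :=
  fun _ _ h _ hz => ⟨hz.1, fun j hj => hz.2 j fun hj' => hj (hj'.trans h)⟩

/-- The moment-angle complex `Z_S`: the blocks `B_σ` glued along the inclusions `B_τ ⊆ B_σ`,
`τ ≤ σ`. -/
def MomentAngle (S : Type*) [PartialOrder S] [OrderBot S] : Type _ :=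
  Glue (block (S := S))

instance instTopologicalSpaceMomentAngle (S : Type*) [PartialOrder S] [OrderBot S] :
    TopologicalSpace (MomentAngle S) :=
  inferInstanceAs (TopologicalSpace (Glue _))

/-- The torus `T^m`. -/
abbrev Torus (S : Type*) [PartialOrder S] [OrderBot S] : Type _ := Vertex S → Circle

/-- Coordinatewise rotation of a block. -/
def rotate {S : Type*} [PartialOrder S] [OrderBot S] (t : Torus S) (σ : S)
    (z : block σ) : block σ :=
  ⟨fun i => (t i : ℂ) * z.1 i,
    fun i => by rw [norm_mul, Circle.norm_coe, one_mul]; exact z.2.1 i,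
    fun j hj => by rw [norm_mul, Circle.norm_coe, one_mul]; exact z.2.2 j hj⟩

/-- The action of `T^m` on `Z_S` induced by the coordinatewise action on the polydisc. -/
instance instMulActionMomentAngle (S : Type*) [PartialOrder S] [OrderBot S] :
    MulAction (Torus S) (MomentAngle S) where
  smul t := Quot.map (fun p => ⟨p.1, rotate t p.1 p.2⟩)
    (fun _ _ h => ⟨h.1, funext fun i => congrArg (fun w => (t i : ℂ) * w) (congrFun h.2 i)⟩)
  one_smul := by
    rintro ⟨σ, z⟩
    exact congrArg (fun w => Quot.mk _ (⟨σ, w⟩ : Σ σ : S, block σ))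
      (Subtype.ext (funext fun i => by simp [rotate]))
  mul_smul := by
    rintro s t ⟨σ, z⟩
    exact congrArg (fun w => Quot.mk _ (⟨σ, w⟩ : Σ σ : S, block σ))
      (Subtype.ext (funext fun i => by simp [rotate, mul_assoc]))

end SimplicialPoset

/-! ### Cones and topological manifolds -/

/-- The cone over `X`: the cylinder `X × [0,1]` together with an apex, with all of `X × {0}`
identified with the apex. The cone over the empty space is a point. -/
def TopologicalCone (X : Type*) : Type _ :=
  Quot (fun p q : (X × unitInterval) ⊕ Unit => ∃ x : X, p = Sum.inl (x, 0) ∧ q = Sum.inr ())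

instance instTopologicalSpaceTopologicalCone (X : Type*) [TopologicalSpace X] :
    TopologicalSpace (TopologicalCone X) :=
  inferInstanceAs (TopologicalSpace (Quot _))

/-- `M` is a topological manifold (without boundary) of dimension `d`: Hausdorff, second
countable, and locally homeomorphic to `ℝ^d`. -/
structure IsTopologicalManifold (d : ℕ) (M : Type*) [TopologicalSpace M] : Prop where
  t2 : T2Space M
  secondCountable : SecondCountableTopology M
  charts : Nonempty (ChartedSpace (EuclideanSpace ℝ (Fin d)) M)

/-!
Let `V` be the vertex set of `S`. A point of `|S|`, or of `Z_S`, lies in a cell `σ` and has weights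
`u : V → ℝ`, nonnegative and supported on `σ`: its barycentric coordinates, respectively the numbers
`1 - ‖z i‖`. Several faces may have the same vertices, so the weights alone do not determine the
point of the glued space. The missing information is recorded by the face coordinates
`f τ = ∏_{i ≤ τ} u i` if `τ ≤ σ` and `f τ = 0` otherwise (`faceProd`). They are compatible with the
gluing, and they separate points, because the face spanned by the support of `u` has a nonzero
coordinate (`exists_common_face`). Since the cells are compact, `|S|` and `Z_S` are thereby closed
subspaces of Euclidean spaces (`isClosedEmbedding_glueCoord`), described through the set `coneSpace S`
of all pairs `(u, f)`. Rescaling `u` by nonnegative factors rescales `f` by their products, so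
`coneSpace S` is a cone over `|S|`, its part of total weight one.

The join: restriction of the coordinates to the vertices of either factor is a continuous bijection
from a compact space to a Hausdorff space (`bijective_joinMap`).

The orbit space: the pair `(u, f)` is a complete invariant of torus orbits, so `Z_S / T^m` is the part
of `coneSpace S` with all weights at most one (`orbitHomeomorph`). Radial rescaling identifies this
part with the cone over `|S|` (`coneHomeomorph`).

The manifold property: if `|S|` is a sphere `S^{n-1}`, radial extension gives `coneSpace S ≃ₜ ℝ^n`
(`coneSpaceHomeomorph`). For a choice of poles `q i` on the unit circle, the Cayley transform in each
coordinate sends the disc without `q i` onto the closed upper half-plane, and the imaginary part of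
the image is a positive continuous multiple of `1 - ‖z i‖`. Taking the real parts as free coordinates
and the imaginary parts as new weights identifies the open subset `{z | ∀ i, z i ≠ q i}` of `Z_S` with
`ℝ^m × coneSpace S ≃ₜ ℝ^(m+n)` (`cayleyHomeomorph`). The poles `±1` suffice to cover `Z_S`. No
information on the links of `S`, which need not be spheres, is used.
-/

open Topology

namespace SimplicialPoset

/-! ### Faces of a simplicial poset -/

section Faces

variable {S : Type*} [PartialOrder S] [OrderBot S] [IsSimplicialPoset S]

/-- Among the faces of a fixed `ρ`, inclusion is detected on vertices. Without the common upper
bound `ρ` this fails: distinct faces of `S` may have the same vertices. -/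
theorem le_of_forall_vertex_le {ρ σ τ : S} (hσ : σ ≤ ρ) (hτ : τ ≤ ρ)
    (h : ∀ i : Vertex S, i.1 ≤ σ → i.1 ≤ τ) : σ ≤ τ := by
  obtain ⟨k, ⟨e⟩⟩ := IsSimplicialPoset.boolean_Iic ρ
  have key : e ⟨σ, hσ⟩ ≤ e ⟨τ, hτ⟩ := by
    intro a ha
    have hat : IsAtom (e.symm {a}) := by
      rw [e.symm.isAtom_iff]
      exact Finset.isAtom_singleton a
    have hv : IsAtom (e.symm {a}).1 := by
      refine ⟨fun h0 => hat.1 (Subtype.ext h0), fun b hb => ?_⟩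
      exact congrArg Subtype.val (hat.2 ⟨b, hb.le.trans (e.symm {a}).2⟩ hb)
    have h1 : e.symm {a} ≤ ⟨σ, hσ⟩ := by
      rw [e.symm_apply_le]
      simpa using ha
    have h2 : e.symm {a} ≤ ⟨τ, hτ⟩ := h ⟨_, hv⟩ h1
    rw [e.symm_apply_le] at h2
    simpa using h2
  exact e.le_iff_le.1 key

theorem exists_face_of_vertices (ρ : S) (I : Set (Vertex S)) (hI : ∀ i ∈ I, i.1 ≤ ρ) :
    ∃ τ ≤ ρ, ∀ i : Vertex S, i.1 ≤ τ ↔ i ∈ I := by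
  classical
  obtain ⟨k, ⟨e⟩⟩ := IsSimplicialPoset.boolean_Iic ρ
  let J : Finset (Fin k) := Finset.univ.filter fun a => ∃ i ∈ I, i.1 = (e.symm {a}).1
  refine ⟨(e.symm J).1, (e.symm J).2, fun i => ?_⟩
  have atom : i.1 ≤ ρ → ∃ a, (e.symm {a}).1 = i.1 := by
    intro hi
    have hat : IsAtom (⟨i.1, hi⟩ : Set.Iic ρ) :=
      ⟨fun h0 => i.2.1 (congrArg Subtype.val h0), fun b hb => Subtype.ext (i.2.2 b.1 hb)⟩
    rw [← e.isAtom_iff, Finset.isAtom_iff] at hat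
    obtain ⟨a, ha⟩ := hat
    exact ⟨a, by rw [← ha]; simp⟩
  constructor
  · intro hi
    obtain ⟨a, ha⟩ := atom (hi.trans (e.symm J).2)
    have h1 : e.symm {a} ≤ e.symm J := by
      rw [← Subtype.coe_le_coe, ha]
      exact hi
    rw [e.symm.le_iff_le] at h1
    have h2 : a ∈ J := h1 (Finset.mem_singleton_self a)
    obtain ⟨i', hi', h3⟩ := (Finset.mem_filter.1 h2).2
    rwa [Subtype.ext (h3.trans ha) ] at hi'
  · intro hi
    obtain ⟨a, ha⟩ := atom (hI i hi)
    have h2 : a ∈ J := Finset.mem_filter.2 ⟨Finset.mem_univ a, i, hi, ha.symm⟩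
    rw [← ha, Subtype.coe_le_coe, e.symm.le_iff_le]
    exact Finset.singleton_subset_iff.2 h2

end Faces

/-! ### The infinite cone in Euclidean space -/

section ConeSpace

variable {S : Type*} [PartialOrder S] [OrderBot S]

/-- The orthant of the face `ρ`: nonnegative weights on the vertices, supported on `ρ`. -/
def orthant (ρ : S) : Set (Vertex S → ℝ) :=
  {u | (∀ i, 0 ≤ u i) ∧ ∀ i : Vertex S, ¬ i.1 ≤ ρ → u i = 0}

theorem zero_mem_orthant (ρ : S) : (0 : Vertex S → ℝ) ∈ orthant ρ :=
  ⟨fun _ => le_rfl, fun _ _ => rfl⟩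

variable [Finite S]

open Classical in
/-- The product of the weights over the vertices of a face. -/
noncomputable def vertexProd (σ : S) (u : Vertex S → ℝ) : ℝ :=
  ∏ i : Vertex S with i.1 ≤ σ, u i

theorem continuous_vertexProd (σ : S) : Continuous (vertexProd σ) := by
  unfold vertexProd; fun_prop

theorem vertexProd_mul (σ : S) (l u : Vertex S → ℝ) :
    vertexProd σ (l * u) = vertexProd σ l * vertexProd σ u := by
  simp [vertexProd, Finset.prod_mul_distrib]

theorem vertexProd_one (σ : S) : vertexProd σ 1 = 1 := by
  simp [vertexProd]

theorem vertexProd_eq_zero {σ : S} {u : Vertex S → ℝ} (i : Vertex S) (hi : i.1 ≤ σ)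
    (h : u i = 0) : vertexProd σ u = 0 := by
  classical
  exact Finset.prod_eq_zero (Finset.mem_filter.2 ⟨Finset.mem_univ i, hi⟩) h

theorem vertexProd_ne_zero {σ : S} {u : Vertex S → ℝ} (h : ∀ i : Vertex S, i.1 ≤ σ → u i ≠ 0) :
    vertexProd σ u ≠ 0 := by
  classical
  exact Finset.prod_ne_zero_iff.2 fun i hi => h i (Finset.mem_filter.1 hi).2

open Classical in
/-- The face coordinates of a point with weights `u` in the cell of `ρ`: the coordinate at `σ` is
the product of the weights of the vertices of `σ` if `σ` is a face of `ρ`, and zero otherwise.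
These coordinates tell apart the cells that have the same vertices. -/
noncomputable def faceProd (ρ : S) (u : Vertex S → ℝ) (σ : S) : ℝ :=
  if σ ≤ ρ then vertexProd σ u else 0

theorem continuous_faceProd (ρ : S) : Continuous (faceProd ρ) := by
  refine continuous_pi fun σ => ?_
  by_cases h : σ ≤ ρ
  · simpa [faceProd, h] using continuous_vertexProd σ
  · simpa [faceProd, h] using continuous_const

/-- A model of the infinite cone over `|S|`, the union of the orthants of `S` glued along
faces. -/
def coneSpace (S : Type*) [PartialOrder S] [OrderBot S] [Finite S] :
    Set ((Vertex S → ℝ) × (S → ℝ)) :=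
  {p | ∃ ρ : S, p.1 ∈ orthant ρ ∧ p.2 = faceProd ρ p.1}

theorem nonneg_of_mem_coneSpace {p : (Vertex S → ℝ) × (S → ℝ)} (hp : p ∈ coneSpace S)
    (i : Vertex S) : 0 ≤ p.1 i := by
  obtain ⟨ρ, h, -⟩ := hp
  exact h.1 i

/-- Rescaling of the weights, with the induced rescaling of the face coordinates. -/
noncomputable def rescale (l : Vertex S → ℝ) (p : (Vertex S → ℝ) × (S → ℝ)) :
    (Vertex S → ℝ) × (S → ℝ) :=
  (l * p.1, fun σ => vertexProd σ l * p.2 σ)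

theorem continuous_rescale :
    Continuous fun q : (Vertex S → ℝ) × ((Vertex S → ℝ) × (S → ℝ)) => rescale q.1 q.2 := by
  have := fun σ : S => continuous_vertexProd σ
  unfold rescale
  fun_prop

theorem rescale_rescale (l l' : Vertex S → ℝ) (p : (Vertex S → ℝ) × (S → ℝ)) :
    rescale l (rescale l' p) = rescale (l * l') p := by
  simp [rescale, vertexProd_mul, mul_assoc]

theorem rescale_one (p : (Vertex S → ℝ) × (S → ℝ)) : rescale 1 p = p := by
  simp [rescale, vertexProd_one]

/-- Rescaling by nonnegative factors preserves the cone, because the face coordinates are products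
of weights. -/
theorem rescale_mem_coneSpace {l : Vertex S → ℝ} (hl : ∀ i, 0 ≤ l i)
    {p : (Vertex S → ℝ) × (S → ℝ)} (hp : p ∈ coneSpace S) : rescale l p ∈ coneSpace S := by
  obtain ⟨ρ, h, hf⟩ := hp
  refine ⟨ρ, ⟨fun i => mul_nonneg (hl i) (h.1 i), fun i hi => ?_⟩, ?_⟩
  · simp [rescale, h.2 i hi]
  · ext σ
    by_cases hσ : σ ≤ ρ <;> simp [rescale, hf, faceProd, hσ, vertexProd_mul]

variable [IsSimplicialPoset S]

/-- The face coordinates of a point do not depend on the cell in which they are computed. -/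
theorem faceProd_eq_of_le {τ ρ : S} (h : τ ≤ ρ) {u : Vertex S → ℝ} (hu : u ∈ orthant τ) :
    faceProd τ u = faceProd ρ u := by
  ext σ
  by_cases h1 : σ ≤ τ
  · simp [faceProd, h1, h1.trans h]
  by_cases h2 : σ ≤ ρ
  · have : ∃ i : Vertex S, i.1 ≤ σ ∧ ¬ i.1 ≤ τ := by
      by_contra! hc
      exact h1 (le_of_forall_vertex_le h2 h hc)
    obtain ⟨i, hi, hi'⟩ := this
    simp [faceProd, h1, h2, vertexProd_eq_zero i hi (hu.2 i hi')]
  · simp [faceProd, h1, h2]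

/-- Equal weights and equal face coordinates in two cells are those of a point in a common face:
the face spanned by the support of the weights has a nonzero face coordinate. -/
theorem exists_common_face {ρ ρ' : S} {u : Vertex S → ℝ} (hu : u ∈ orthant ρ)
    (h : faceProd ρ u = faceProd ρ' u) : ∃ τ, τ ≤ ρ ∧ τ ≤ ρ' ∧ u ∈ orthant τ := by
  -- The face `τ` of `ρ` spanned by the support of `u` has a nonzero coordinate, so it is below `ρ'`.
  obtain ⟨τ, hτ, hv⟩ := exists_face_of_vertices ρ {i | u i ≠ 0}
    fun i hi => by_contra fun hc => hi (hu.2 i hc)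
  refine ⟨τ, hτ, ?_, hu.1, fun i hi => ?_⟩
  · by_contra hc
    have h1 := congrFun h τ
    simp only [faceProd, hτ, hc, if_true, if_false] at h1
    exact vertexProd_ne_zero (fun i hi => (hv i).1 hi) h1
  · by_contra hc
    exact hi ((hv i).2 hc)

/-- The apex of the cone. -/
noncomputable def apex (S : Type*) [PartialOrder S] [OrderBot S] [Finite S] :
    (Vertex S → ℝ) × (S → ℝ) :=
  (0, faceProd ⊥ 0)

theorem apex_mem_coneSpace (S : Type*) [PartialOrder S] [OrderBot S] [Finite S] :
    apex S ∈ coneSpace S :=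
  ⟨⊥, zero_mem_orthant _, rfl⟩

theorem eq_apex_of_fst_eq_zero {p : (Vertex S → ℝ) × (S → ℝ)} (hp : p ∈ coneSpace S)
    (h : p.1 = 0) : p = apex S := by
  obtain ⟨ρ, -, hf⟩ := hp
  refine Prod.ext h ?_
  rw [hf, h]
  exact (faceProd_eq_of_le bot_le (zero_mem_orthant _)).symm

end ConeSpace

/-! ### Euclidean models of glued spaces -/

theorem compactSpace_glue {S X : Type*} [PartialOrder S] [Finite S] [TopologicalSpace X]
    {A : S → Set X} (hK : ∀ ρ, IsCompact (A ρ)) : CompactSpace (Glue A) := by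
  have := fun ρ => isCompact_iff_compactSpace.1 (hK ρ)
  exact inferInstanceAs (CompactSpace (Quot _))

section Embedding

variable {S X : Type*} [PartialOrder S] [OrderBot S] [Finite S] [IsSimplicialPoset S]
  {A : S → Set X} {w : X → Vertex S → ℝ} {K : Set X}

/-- The coordinates of a point of a glued space whose cells are cut out by the condition that the
weights `w` lie in the corresponding orthants. -/
noncomputable def glueCoord (hA : ∀ ρ x, x ∈ A ρ ↔ x ∈ K ∧ w x ∈ orthant ρ) :
    Glue A → X × (S → ℝ) :=
  Quot.lift (fun p => (p.2.1, faceProd p.1 (w p.2.1))) (by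
    rintro ⟨τ, x, hx⟩ ⟨ρ, y, hy⟩ ⟨h, hxy⟩
    obtain rfl : x = y := hxy
    exact Prod.ext rfl (faceProd_eq_of_le h ((hA _ _).1 hx).2))

theorem glueCoord_injective (hA : ∀ ρ x, x ∈ A ρ ↔ x ∈ K ∧ w x ∈ orthant ρ) :
    Function.Injective (glueCoord hA) := by
  rintro ⟨ρ, x, hx⟩ ⟨ρ', y, hy⟩ h
  obtain rfl : x = y := congrArg Prod.fst h
  obtain ⟨τ, h1, h2, h3⟩ := exists_common_face ((hA _ _).1 hx).2 (congrArg Prod.snd h)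
  have hτ : x ∈ A τ := (hA _ _).2 ⟨((hA _ _).1 hx).1, h3⟩
  exact (Quot.sound (r := fun p q : (Σ σ : S, A σ) => p.1 ≤ q.1 ∧ (p.2 : X) = (q.2 : X))
    (a := ⟨τ, x, hτ⟩) (b := ⟨ρ, x, hx⟩) ⟨h1, rfl⟩).symm.trans (Quot.sound ⟨h2, rfl⟩)

/-- The image of a glued space is the part of `K × (S → ℝ)` that the weights carry into the
cone. -/
theorem range_glueCoord (hA : ∀ ρ x, x ∈ A ρ ↔ x ∈ K ∧ w x ∈ orthant ρ) :
    Set.range (glueCoord hA) = {q | q.1 ∈ K ∧ (w q.1, q.2) ∈ coneSpace S} := by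
  ext ⟨x, f⟩
  constructor
  · rintro ⟨⟨ρ, y, hy⟩, h⟩
    obtain ⟨rfl, rfl⟩ := Prod.ext_iff.1 h
    exact ⟨((hA _ _).1 hy).1, ρ, ((hA _ _).1 hy).2, rfl⟩
  · rintro ⟨hx, ρ, h1, h2⟩
    refine ⟨Quot.mk _ ⟨ρ, x, (hA _ _).2 ⟨hx, h1⟩⟩, Prod.ext rfl ?_⟩
    exact h2.symm

variable [TopologicalSpace X]

theorem continuous_glueCoord (hA : ∀ ρ x, x ∈ A ρ ↔ x ∈ K ∧ w x ∈ orthant ρ)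
    (hw : Continuous w) : Continuous (glueCoord hA) := by
  refine continuous_quot_lift _ (continuous_sigma fun ρ => ?_)
  have := (continuous_faceProd ρ).comp (hw.comp (continuous_subtype_val (p := (· ∈ A ρ))))
  exact continuous_subtype_val.prodMk this

/-- A glued space with compact cells is compact, so its injective coordinates are a closed
embedding. In particular the quotient topology is the subspace topology. -/
theorem isClosedEmbedding_glueCoord [T2Space X]
    (hA : ∀ ρ x, x ∈ A ρ ↔ x ∈ K ∧ w x ∈ orthant ρ) (hw : Continuous w)
    (hK : ∀ ρ, IsCompact (A ρ)) : IsClosedEmbedding (glueCoord hA) := by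
  have := compactSpace_glue hK
  exact (continuous_glueCoord hA hw).isClosedEmbedding (glueCoord_injective hA)

end Embedding

/-! ### The moment-angle complex and the realization as Euclidean subspaces -/

section Coordinates

/-- The weights of a point of the polydisc: the distances of its coordinates to the unit
circle. -/
noncomputable def depth {V : Type*} (z : V → ℂ) : V → ℝ := fun i => 1 - ‖z i‖

theorem continuous_depth {V : Type*} : Continuous (depth : (V → ℂ) → V → ℝ) := by
  unfold depth; fun_prop

variable {S : Type*} [PartialOrder S] [OrderBot S]

theorem mem_block_iff (ρ : S) (z : Vertex S → ℂ) :
    z ∈ block ρ ↔ z ∈ Set.univ ∧ depth z ∈ orthant ρ := by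
  simp only [block, orthant, depth, Set.mem_ofPred_eq, Set.mem_univ, true_and, sub_nonneg,
    sub_eq_zero, eq_comm (a := (1 : ℝ))]

theorem isCompact_block [Finite S] (ρ : S) : IsCompact (block ρ) := by
  have hc : IsClosed (block ρ) := by
    have h : block ρ = (⋂ i, {z | ‖z i‖ ≤ 1}) ∩
        ⋂ (j : Vertex S) (_ : ¬ j.1 ≤ ρ), {z | ‖z j‖ = 1} := by
      ext z; simp [block]
    rw [h]
    exact (isClosed_iInter fun i => isClosed_le (by fun_prop) continuous_const).inter
      (isClosed_iInter fun i => isClosed_iInter fun _ => isClosed_eq (by fun_prop) continuous_const)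
  refine (isCompact_univ_pi fun _ : Vertex S => isCompact_closedBall (0 : ℂ) 1).of_isClosed_subset
    hc fun z hz i _ => ?_
  simpa using hz.1 i

variable [Finite S]

theorem mem_simplex_iff (ρ : S) (x : Vertex S → ℝ) :
    x ∈ simplex ρ ↔ x ∈ {x | ∑ i, x i = 1} ∧ x ∈ orthant ρ := by
  simp only [simplex, stdSimplex, orthant, Set.mem_ofPred_eq]
  tauto

theorem isCompact_simplex (ρ : S) : IsCompact (simplex ρ) := by
  have h : simplex ρ = stdSimplex ℝ (Vertex S) ∩
      ⋂ (j : Vertex S) (_ : ¬ j.1 ≤ ρ), {x | x j = 0} := by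
    ext z; simp [simplex]
  rw [h]
  exact (isCompact_stdSimplex ℝ _).inter_right
    (isClosed_iInter fun i => isClosed_iInter fun _ => isClosed_eq (by fun_prop) continuous_const)

instance instCompactSpaceMomentAngle : CompactSpace (MomentAngle S) :=
  compactSpace_glue isCompact_block

instance instCompactSpaceRealization : CompactSpace (Realization S) :=
  compactSpace_glue isCompact_simplex

variable [IsSimplicialPoset S]

/-- The embedding of the moment-angle complex in a Euclidean space. -/
noncomputable def momentAngleCoord : MomentAngle S → (Vertex S → ℂ) × (S → ℝ) :=
  glueCoord (w := depth) mem_block_iff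

theorem isClosedEmbedding_momentAngleCoord :
    IsClosedEmbedding (momentAngleCoord : MomentAngle S → _) :=
  isClosedEmbedding_glueCoord mem_block_iff continuous_depth isCompact_block

theorem range_momentAngleCoord : Set.range (momentAngleCoord : MomentAngle S → _) =
    {q | (depth q.1, q.2) ∈ coneSpace S} := by
  refine (range_glueCoord mem_block_iff).trans ?_
  simp

/-- The embedding of the realization in a Euclidean space. -/
noncomputable def realizationCoord : Realization S → (Vertex S → ℝ) × (S → ℝ) :=
  glueCoord (w := id) mem_simplex_iff

theorem isClosedEmbedding_realizationCoord :
    IsClosedEmbedding (realizationCoord : Realization S → _) :=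
  isClosedEmbedding_glueCoord mem_simplex_iff continuous_id isCompact_simplex

theorem range_realizationCoord : Set.range (realizationCoord : Realization S → _) =
    {p | ∑ i, p.1 i = 1 ∧ p ∈ coneSpace S} :=
  range_glueCoord mem_simplex_iff

instance instT2SpaceMomentAngle : T2Space (MomentAngle S) :=
  isClosedEmbedding_momentAngleCoord.isEmbedding.t2Space

end Coordinates

/-! ### The moment-angle complex of a join -/

section Join

variable {S₁ S₂ : Type*} [PartialOrder S₁] [OrderBot S₁] [PartialOrder S₂] [OrderBot S₂]

theorem isAtom_join_iff (σ : Join S₁ S₂) :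
    IsAtom σ ↔ IsAtom σ.1 ∧ σ.2 = ⊥ ∨ σ.1 = ⊥ ∧ IsAtom σ.2 := by
  obtain ⟨a, b⟩ := σ
  constructor
  · intro h
    by_cases ha : a = ⊥
    · subst ha
      refine Or.inr ⟨rfl, fun hb => h.1 (Prod.ext rfl hb), fun c hc => ?_⟩
      exact congrArg Prod.snd (h.2 (⊥, c) (Prod.mk_lt_mk_iff_right.2 hc))
    · -- If neither coordinate were minimal, then `(a, ⊥)` would lie strictly between `⊥` and `(a, b)`.
      have hb : b = ⊥ := by
        by_contra hb
        have := h.2 (a, ⊥) (Prod.mk_lt_mk_iff_right.2 (bot_lt_iff_ne_bot.2 hb))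
        exact ha (congrArg Prod.fst this)
      subst hb
      refine Or.inl ⟨⟨ha, fun c hc => ?_⟩, rfl⟩
      exact congrArg Prod.fst (h.2 (c, ⊥) (Prod.mk_lt_mk_iff_left.2 hc))
  · rintro (⟨h, rfl : b = ⊥⟩ | ⟨rfl : a = ⊥, h⟩)
    · refine ⟨fun h0 => h.1 (congrArg Prod.fst h0), fun ⟨c, d⟩ hc => ?_⟩
      obtain rfl := le_bot_iff.1 hc.le.2
      exact Prod.ext (h.2 c (Prod.mk_lt_mk_iff_left.1 hc)) rfl
    · refine ⟨fun h0 => h.1 (congrArg Prod.snd h0), fun ⟨c, d⟩ hc => ?_⟩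
      obtain rfl := le_bot_iff.1 hc.le.1
      exact Prod.ext rfl (h.2 d (Prod.mk_lt_mk_iff_right.1 hc))

/-- A vertex of the first factor, as a vertex of the join. -/
def Vertex.inl (i : Vertex S₁) : Vertex (Join S₁ S₂) :=
  ⟨(i.1, ⊥), (isAtom_join_iff _).2 (Or.inl ⟨i.2, rfl⟩)⟩

/-- A vertex of the second factor, as a vertex of the join. -/
def Vertex.inr (i : Vertex S₂) : Vertex (Join S₁ S₂) :=
  ⟨(⊥, i.1), (isAtom_join_iff _).2 (Or.inr ⟨rfl, i.2⟩)⟩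

theorem Vertex.eq_inl_or_inr (i : Vertex (Join S₁ S₂)) :
    (∃ j, i = Vertex.inl j) ∨ ∃ j, i = Vertex.inr j := by
  obtain ⟨⟨a, b⟩, h⟩ := i
  rcases (isAtom_join_iff _).1 h with ⟨h1, h2⟩ | ⟨h1, h2⟩
  · exact Or.inl ⟨⟨a, h1⟩, Subtype.ext (Prod.ext rfl h2)⟩
  · exact Or.inr ⟨⟨b, h2⟩, Subtype.ext (Prod.ext h1 rfl)⟩

theorem Vertex.inl_le_iff (i : Vertex S₁) (σ : Join S₁ S₂) :
    (Vertex.inl i : Vertex (Join S₁ S₂)).1 ≤ σ ↔ i.1 ≤ σ.1 :=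
  ⟨fun h => h.1, fun h => ⟨h, bot_le⟩⟩

theorem Vertex.inr_le_iff (i : Vertex S₂) (σ : Join S₁ S₂) :
    (Vertex.inr i : Vertex (Join S₁ S₂)).1 ≤ σ ↔ i.1 ≤ σ.2 :=
  ⟨fun h => h.2, fun h => ⟨bot_le, h⟩⟩

theorem mem_block_join_iff (σ : Join S₁ S₂) (z : Vertex (Join S₁ S₂) → ℂ) :
    z ∈ block σ ↔ z ∘ Vertex.inl ∈ block σ.1 ∧ z ∘ Vertex.inr ∈ block σ.2 := by
  constructor
  · exact fun h => ⟨⟨fun i => h.1 _, fun i hi => h.2 _ (mt (Vertex.inl_le_iff i σ).1 hi)⟩,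
      ⟨fun i => h.1 _, fun i hi => h.2 _ (mt (Vertex.inr_le_iff i σ).1 hi)⟩⟩
  · rintro ⟨h1, h2⟩
    refine ⟨fun i => ?_, fun i hi => ?_⟩
    · obtain ⟨j, rfl⟩ | ⟨j, rfl⟩ := i.eq_inl_or_inr
      exacts [h1.1 j, h2.1 j]
    · obtain ⟨j, rfl⟩ | ⟨j, rfl⟩ := i.eq_inl_or_inr
      exacts [h1.2 j (mt (Vertex.inl_le_iff j σ).2 hi), h2.2 j (mt (Vertex.inr_le_iff j σ).2 hi)]

/-- The point of the moment-angle complex represented by a point of a block. -/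
def MomentAngle.mk {S : Type*} [PartialOrder S] [OrderBot S] (σ : S) (z : Vertex S → ℂ)
    (hz : z ∈ block σ) : MomentAngle S :=
  Quot.mk _ ⟨σ, z, hz⟩

theorem MomentAngle.continuous_mk {S Y : Type*} [PartialOrder S] [OrderBot S]
    [TopologicalSpace Y] (σ : S) {z : Y → Vertex S → ℂ} (hz : Continuous z)
    (h : ∀ y, z y ∈ block σ) : Continuous fun y => MomentAngle.mk σ (z y) (h y) :=
  continuous_quot_mk.comp ((continuous_sigmaMk (i := σ)).comp (hz.subtype_mk h))

theorem MomentAngle.mk_eq_of_le {S : Type*} [PartialOrder S] [OrderBot S] {τ σ : S} (h : τ ≤ σ)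
    (z : Vertex S → ℂ) (hz : z ∈ block τ) :
    MomentAngle.mk τ z hz = MomentAngle.mk σ z (block_mono h hz) :=
  Quot.sound ⟨h, rfl⟩

theorem MomentAngle.mk_eq_iff {S : Type*} [PartialOrder S] [OrderBot S] [Finite S]
    [IsSimplicialPoset S] {σ σ' : S} {z z' : Vertex S → ℂ} (hz : z ∈ block σ)
    (hz' : z' ∈ block σ') : MomentAngle.mk σ z hz = MomentAngle.mk σ' z' hz' ↔
      z = z' ∧ ∃ τ, τ ≤ σ ∧ τ ≤ σ' ∧ z ∈ block τ := by
  constructor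
  · intro h
    have h' := congrArg momentAngleCoord h
    obtain rfl : z = z' := congrArg Prod.fst h'
    obtain ⟨τ, h1, h2, h3⟩ := exists_common_face ((mem_block_iff _ _).1 hz).2
      (congrArg Prod.snd h')
    exact ⟨rfl, τ, h1, h2, (mem_block_iff _ _).2 ⟨trivial, h3⟩⟩
  · rintro ⟨rfl, τ, h1, h2, h3⟩
    exact (MomentAngle.mk_eq_of_le h1 z h3).symm.trans (MomentAngle.mk_eq_of_le h2 z h3)

/-- The map to the product that restricts the coordinates to the vertices of each factor. -/
def joinMap : MomentAngle (Join S₁ S₂) → MomentAngle S₁ × MomentAngle S₂ :=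
  Quot.lift (fun p =>
    (MomentAngle.mk p.1.1 (p.2.1 ∘ Vertex.inl) ((mem_block_join_iff _ _).1 p.2.2).1,
      MomentAngle.mk p.1.2 (p.2.1 ∘ Vertex.inr) ((mem_block_join_iff _ _).1 p.2.2).2)) (by
    rintro ⟨τ, x, hx⟩ ⟨ρ, y, hy⟩ ⟨h, hxy⟩
    obtain rfl : x = y := hxy
    exact Prod.ext (MomentAngle.mk_eq_of_le h.1 _ _) (MomentAngle.mk_eq_of_le h.2 _ _))

theorem continuous_joinMap : Continuous (joinMap (S₁ := S₁) (S₂ := S₂)) := by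
  refine continuous_quot_lift _ (continuous_sigma fun σ => Continuous.prodMk ?_ ?_)
  · exact MomentAngle.continuous_mk σ.1 (continuous_pi fun i =>
      (continuous_apply (Vertex.inl i)).comp (continuous_subtype_val (p := (· ∈ block σ)))) _
  · exact MomentAngle.continuous_mk σ.2 (continuous_pi fun i =>
      (continuous_apply (Vertex.inr i)).comp (continuous_subtype_val (p := (· ∈ block σ)))) _

variable [Finite S₁] [Finite S₂] [IsSimplicialPoset S₁] [IsSimplicialPoset S₂]

theorem bijective_joinMap : Function.Bijective (joinMap (S₁ := S₁) (S₂ := S₂)) := by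
  constructor
  · rintro ⟨σ, z, hz⟩ ⟨σ', z', hz'⟩ h
    obtain ⟨e1, τ₁, h1, h1', hτ₁⟩ := (MomentAngle.mk_eq_iff _ _).1 (congrArg Prod.fst h)
    obtain ⟨e2, τ₂, h2, h2', hτ₂⟩ := (MomentAngle.mk_eq_iff _ _).1 (congrArg Prod.snd h)
    refine (MomentAngle.mk_eq_iff hz hz').2 ⟨?_, (τ₁, τ₂), ⟨h1, h2⟩, ⟨h1', h2'⟩,
      (mem_block_join_iff _ _).2 ⟨hτ₁, hτ₂⟩⟩
    ext i
    obtain ⟨j, rfl⟩ | ⟨j, rfl⟩ := i.eq_inl_or_inr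
    exacts [congrFun e1 j, congrFun e2 j]
  · rintro ⟨⟨σ₁, z₁, h₁⟩, ⟨σ₂, z₂, h₂⟩⟩
    classical
    let z : Vertex (Join S₁ S₂) → ℂ := fun i =>
      if h : IsAtom i.1.1 then z₁ ⟨i.1.1, h⟩ else if h : IsAtom i.1.2 then z₂ ⟨i.1.2, h⟩ else 0
    have e1 : z ∘ Vertex.inl = z₁ := funext fun i => dif_pos i.2
    have e2 : z ∘ Vertex.inr = z₂ := funext fun i =>
      (dif_neg fun h : IsAtom (⊥ : S₁) => h.1 rfl).trans (dif_pos i.2)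
    refine ⟨MomentAngle.mk (σ₁, σ₂) z ((mem_block_join_iff _ _).2 ?_), ?_⟩
    · rw [e1, e2]
      exact ⟨h₁, h₂⟩
    · refine Prod.ext ?_ ?_
      · refine (MomentAngle.mk_eq_iff _ _).2 ⟨e1, σ₁, le_rfl, le_rfl, ?_⟩
        rwa [e1]
      · refine (MomentAngle.mk_eq_iff _ _).2 ⟨e2, σ₂, le_rfl, le_rfl, ?_⟩
        rwa [e2]

theorem nonempty_homeomorph_join :
    Nonempty (MomentAngle (Join S₁ S₂) ≃ₜ MomentAngle S₁ × MomentAngle S₂) :=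
  ⟨Continuous.homeoOfEquivCompactToT2 (f := Equiv.ofBijective _ bijective_joinMap)
    continuous_joinMap⟩

end Join

/-! ### The orbit space -/

section Orbits

variable {S : Type*} [PartialOrder S] [OrderBot S]

/-- The cubical cone over `S`: the part of the infinite cone with all weights at most one. -/
def cubicalCone (S : Type*) [PartialOrder S] [OrderBot S] [Finite S] :
    Set ((Vertex S → ℝ) × (S → ℝ)) :=
  {p | p ∈ coneSpace S ∧ ∀ i, p.1 i ≤ 1}

theorem depth_rotate (t : Torus S) (z : Vertex S → ℂ) :
    depth (fun i => (t i : ℂ) * z i) = depth z := by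
  ext i
  rw [depth, norm_mul, Circle.norm_coe, one_mul]
  rfl

theorem exists_rotate_eq {z z' : Vertex S → ℂ} (h : depth z = depth z') :
    ∃ t : Torus S, (fun i => (t i : ℂ) * z i) = z' := by
  have key : ∀ i, ∃ t : Circle, (t : ℂ) * z i = z' i := by
    intro i
    have hi : ‖z i‖ = ‖z' i‖ := by simpa [depth] using congrFun h i
    by_cases h0 : z i = 0
    · exact ⟨1, by simpa [h0, eq_comm] using hi⟩
    · refine ⟨⟨z' i / z i, ?_⟩, div_mul_cancel₀ _ h0⟩
      simp [Submonoid.unitSphere, ← hi, h0]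
  choose t ht using key
  exact ⟨t, funext ht⟩

variable [Finite S] [IsSimplicialPoset S]

/-- The weights and face coordinates of a point of the moment-angle complex. -/
noncomputable def momentAngleWeights (x : MomentAngle S) : (Vertex S → ℝ) × (S → ℝ) :=
  (depth (momentAngleCoord x).1, (momentAngleCoord x).2)

theorem continuous_momentAngleWeights : Continuous (momentAngleWeights (S := S)) := by
  have := (isClosedEmbedding_momentAngleCoord (S := S)).continuous
  exact (continuous_depth.comp (continuous_fst.comp this)).prodMk (continuous_snd.comp this)

theorem momentAngleWeights_smul (t : Torus S) (x : MomentAngle S) :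
    momentAngleWeights (t • x) = momentAngleWeights x := by
  obtain ⟨σ, z, hz⟩ := x
  refine Prod.ext (depth_rotate t z) ?_
  exact congrArg (faceProd σ) (depth_rotate t z)

/-- The weights and face coordinates separate the torus orbits. -/
theorem exists_smul_eq_of_weights {x y : MomentAngle S}
    (h : momentAngleWeights x = momentAngleWeights y) : ∃ t : Torus S, t • x = y := by
  obtain ⟨σ, z, hz⟩ := x
  obtain ⟨t, ht⟩ := exists_rotate_eq (congrArg Prod.fst h)
  refine ⟨t, (isClosedEmbedding_momentAngleCoord (S := S)).injective (Prod.ext ht ?_)⟩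
  have h2 := congrArg Prod.snd h
  refine Eq.trans ?_ h2
  exact congrArg (faceProd σ) (depth_rotate t z)

/-- The map induced by the weights on the orbit space. -/
noncomputable def orbitMap : MulAction.orbitRel.Quotient (Torus S) (MomentAngle S) →
    (Vertex S → ℝ) × (S → ℝ) :=
  Quotient.lift momentAngleWeights (by
    rintro x y ⟨t, rfl⟩
    exact momentAngleWeights_smul t y)

theorem isClosedEmbedding_orbitMap : IsClosedEmbedding (orbitMap (S := S)) := by
  refine (continuous_momentAngleWeights.quotient_lift _).isClosedEmbedding ?_
  rintro ⟨x⟩ ⟨y⟩ h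
  obtain ⟨t, ht⟩ := exists_smul_eq_of_weights (S := S) (x := y) (y := x) h.symm
  exact Quotient.sound ⟨t, ht⟩

theorem range_orbitMap : Set.range (orbitMap (S := S)) = cubicalCone S := by
  ext p
  constructor
  · rintro ⟨⟨x⟩, rfl⟩
    have : momentAngleCoord x ∈ Set.range (momentAngleCoord (S := S)) := ⟨x, rfl⟩
    rw [range_momentAngleCoord] at this
    exact ⟨this, fun i => sub_le_self _ (norm_nonneg _)⟩
  · -- The polydisc point with the real coordinates `1 - p.1 i` has weights `p.1`.
    rintro ⟨hp, h1⟩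
    have hd : depth (fun i => ((1 - p.1 i : ℝ) : ℂ)) = p.1 := by
      ext i
      rw [depth, Complex.norm_real, Real.norm_of_nonneg (sub_nonneg.2 (h1 i)), sub_sub_cancel]
    have : ((fun i => ((1 - p.1 i : ℝ) : ℂ)), p.2) ∈ Set.range (momentAngleCoord (S := S)) := by
      rw [range_momentAngleCoord, Set.mem_ofPred_eq, hd]
      exact hp
    obtain ⟨x, hx⟩ := this
    refine ⟨Quotient.mk _ x, ?_⟩
    change (depth (momentAngleCoord x).1, (momentAngleCoord x).2) = p
    rw [hx]
    exact Prod.ext hd rfl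

/-- The orbit space is the cubical cone. -/
noncomputable def orbitHomeomorph :
    MulAction.orbitRel.Quotient (Torus S) (MomentAngle S) ≃ₜ cubicalCone S :=
  isClosedEmbedding_orbitMap.isEmbedding.toHomeomorph.trans
    (Homeomorph.setCongr range_orbitMap)

end Orbits

/-! ### The cone over the realization -/

section Cone

variable {S : Type*} [PartialOrder S] [OrderBot S] [Finite S]

/-- Rescaling of all weights by the same number. -/
noncomputable def dilate (t : ℝ) (p : (Vertex S → ℝ) × (S → ℝ)) : (Vertex S → ℝ) × (S → ℝ) :=
  rescale (fun _ => t) p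

theorem continuous_dilate :
    Continuous fun q : ℝ × ((Vertex S → ℝ) × (S → ℝ)) => dilate q.1 q.2 :=
  continuous_rescale.comp ((continuous_pi fun _ => continuous_fst).prodMk continuous_snd)

theorem dilate_fst (t : ℝ) (p : (Vertex S → ℝ) × (S → ℝ)) : (dilate t p).1 = t • p.1 := rfl

theorem dilate_mem_coneSpace {t : ℝ} (ht : 0 ≤ t) {p : (Vertex S → ℝ) × (S → ℝ)}
    (hp : p ∈ coneSpace S) : dilate t p ∈ coneSpace S :=
  rescale_mem_coneSpace (fun _ => ht) hp

theorem dilate_dilate (s t : ℝ) (p : (Vertex S → ℝ) × (S → ℝ)) :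
    dilate s (dilate t p) = dilate (s * t) p :=
  rescale_rescale _ _ p

theorem dilate_one (p : (Vertex S → ℝ) × (S → ℝ)) : dilate 1 p = p :=
  rescale_one p

variable [IsSimplicialPoset S]

/-- Dilation by zero sends the whole cone to its apex. -/
theorem dilate_zero {p : (Vertex S → ℝ) × (S → ℝ)} (hp : p ∈ coneSpace S) :
    dilate 0 p = apex S :=
  eq_apex_of_fst_eq_zero (dilate_mem_coneSpace le_rfl hp) (by simp [dilate_fst])

theorem realizationCoord_mem (x : Realization S) :
    ∑ i, (realizationCoord x).1 i = 1 ∧ realizationCoord x ∈ coneSpace S := by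
  have : realizationCoord x ∈ Set.range (realizationCoord (S := S)) := ⟨x, rfl⟩
  rwa [range_realizationCoord] at this

theorem exists_realizationCoord_eq {p : (Vertex S → ℝ) × (S → ℝ)} (hp : p ∈ coneSpace S)
    (h : ∑ i, p.1 i = 1) : ∃ x, realizationCoord x = p := by
  have : p ∈ Set.range (realizationCoord (S := S)) := by
    rw [range_realizationCoord]
    exact ⟨h, hp⟩
  exact this

theorem sum_pos_of_mem_coneSpace {p : (Vertex S → ℝ) × (S → ℝ)} (hp : p ∈ coneSpace S)
    (h : p ≠ apex S) : 0 < ∑ i, p.1 i := by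
  have h0 := nonneg_of_mem_coneSpace hp
  refine lt_of_le_of_ne (Finset.sum_nonneg fun i _ => h0 i) fun hs => h ?_
  refine eq_apex_of_fst_eq_zero hp (funext fun i => ?_)
  exact (Finset.sum_eq_zero_iff_of_nonneg fun i _ => h0 i).1 hs.symm i (Finset.mem_univ i)

/-- Polar coordinates on the cone: a point other than the apex is a positive dilate of a unique
point of the realization. -/
theorem exists_dilate_eq {p : (Vertex S → ℝ) × (S → ℝ)} (hp : p ∈ coneSpace S)
    (h : p ≠ apex S) : ∃ x : Realization S, dilate (∑ i, p.1 i) (realizationCoord x) = p ∧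
      realizationCoord x = dilate (∑ i, p.1 i)⁻¹ p := by
  have hs := sum_pos_of_mem_coneSpace hp h
  obtain ⟨x, hx⟩ := exists_realizationCoord_eq (dilate_mem_coneSpace (inv_nonneg.2 hs.le) hp)
    (by simp [dilate_fst, ← Finset.mul_sum, hs.ne'])
  refine ⟨x, ?_, hx⟩
  rw [hx, dilate_dilate, mul_inv_cancel₀ hs.ne', dilate_one]

theorem sum_dilate_realizationCoord (t : ℝ) (x : Realization S) :
    ∑ i, (dilate t (realizationCoord x)).1 i = t := by
  simp [dilate_fst, ← Finset.mul_sum, (realizationCoord_mem x).1]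

theorem norm_realizationCoord_pos (x : Realization S) : 0 < ‖(realizationCoord x).1‖ := by
  refine norm_pos_iff.2 fun h => ?_
  have := (realizationCoord_mem x).1
  simp [h] at this

/-- The point at height `t` of the segment that leads from the apex through a point of the
realization to the outer boundary of the cubical cone. The sup norm of its weights is `t`. -/
noncomputable def coneMapAux : (Realization S × unitInterval) ⊕ Unit → cubicalCone S :=
  Sum.elim
    (fun q => ⟨dilate (q.2 / ‖(realizationCoord q.1).1‖) (realizationCoord q.1),
      dilate_mem_coneSpace (div_nonneg q.2.2.1 (norm_nonneg _)) (realizationCoord_mem q.1).2,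
      fun i => by
        have h1 := norm_realizationCoord_pos q.1
        have h2 := (le_abs_self _).trans (norm_le_pi_norm (realizationCoord q.1).1 i)
        rw [dilate_fst, Pi.smul_apply, smul_eq_mul, div_mul_eq_mul_div, div_le_one h1]
        exact (mul_le_mul q.2.2.2 h2 (nonneg_of_mem_coneSpace (realizationCoord_mem q.1).2 i)
          zero_le_one).trans_eq (one_mul _)⟩)
    (fun _ => ⟨apex S, apex_mem_coneSpace S, fun _ => zero_le_one⟩)

theorem continuous_coneMapAux : Continuous (coneMapAux (S := S)) := by
  refine Continuous.sumElim (Continuous.subtype_mk ?_ _) continuous_const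
  have hc := (isClosedEmbedding_realizationCoord (S := S)).continuous
  refine continuous_dilate.comp (Continuous.prodMk ?_ (hc.comp continuous_fst))
  exact (continuous_subtype_val.comp continuous_snd).div₀ (by fun_prop)
    fun q => (norm_realizationCoord_pos q.1).ne'

/-- The map from the cone over the realization to the cubical cone. -/
noncomputable def coneMap : TopologicalCone (Realization S) → cubicalCone S :=
  Quot.lift coneMapAux (by
    rintro _ _ ⟨x, rfl, rfl⟩
    refine Subtype.ext ?_
    simpa [coneMapAux] using dilate_zero (realizationCoord_mem x).2)

theorem bijective_coneMap : Function.Bijective (coneMap (S := S)) := by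
  have hapex : ∀ (x : Realization S) (t : unitInterval),
      (coneMapAux (Sum.inl (x, t)) : (Vertex S → ℝ) × (S → ℝ)) = apex S → t = 0 := by
    intro x t h
    have h1 : ∑ i, (dilate (t / ‖(realizationCoord x).1‖) (realizationCoord x)).1 i = 0 := by
      rw [show dilate (t / ‖(realizationCoord x).1‖) (realizationCoord x) = apex S from h]
      simp [apex]
    rw [sum_dilate_realizationCoord, div_eq_zero_iff] at h1
    exact Subtype.ext (h1.resolve_right (norm_realizationCoord_pos x).ne')
  have hzero : ∀ x : Realization S, (Quot.mk _ (Sum.inl (x, 0)) : TopologicalCone (Realization S))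
      = Quot.mk _ (Sum.inr ()) := fun x => Quot.sound ⟨x, rfl, rfl⟩
  constructor
  · rintro ⟨⟨x, t⟩ | ⟨⟩⟩ ⟨⟨y, s⟩ | ⟨⟩⟩ h
    · have h' : dilate (t / ‖(realizationCoord x).1‖) (realizationCoord x) =
          dilate (s / ‖(realizationCoord y).1‖) (realizationCoord y) := congrArg Subtype.val h
      have hx := norm_realizationCoord_pos x
      have hy := norm_realizationCoord_pos y
      -- The height is the sup norm of the weights.
      have hts : (t : ℝ) = s := by
        have := congrArg (fun p => ‖p.1‖) h'
        simpa only [dilate_fst, norm_smul, norm_div, norm_norm, div_mul_cancel₀ _ hx.ne',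
          div_mul_cancel₀ _ hy.ne', Real.norm_of_nonneg t.2.1, Real.norm_of_nonneg s.2.1] using this
      obtain rfl : t = s := Subtype.ext hts
      by_cases ht : t = 0
      · subst ht
        exact (hzero x).trans (hzero y).symm
      -- Points of the realization have total weight one, so the two dilation factors agree.
      have hc := congrArg (fun p => ∑ i, p.1 i) h'
      simp only [sum_dilate_realizationCoord] at hc
      rw [← hc] at h'
      have hne : (t : ℝ) / ‖(realizationCoord x).1‖ ≠ 0 :=
        div_ne_zero (fun h0 => ht (Subtype.ext h0)) hx.ne'
      have h2 := congrArg (dilate ((t : ℝ) / ‖(realizationCoord x).1‖)⁻¹) h'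
      simp only [dilate_dilate, inv_mul_cancel₀ hne, dilate_one] at h2
      obtain rfl := (isClosedEmbedding_realizationCoord (S := S)).injective h2
      rfl
    · obtain rfl := hapex x t (congrArg Subtype.val h)
      exact hzero x
    · obtain rfl := hapex y s (congrArg Subtype.val h).symm
      exact (hzero y).symm
    · rfl
  · rintro ⟨p, hp, h1⟩
    by_cases h : p = apex S
    · exact ⟨Quot.mk _ (Sum.inr ()), Subtype.ext h.symm⟩
    · obtain ⟨x, hx, -⟩ := exists_dilate_eq hp h
      refine ⟨Quot.mk _ (Sum.inl (x, ⟨‖p.1‖, norm_nonneg _, ?_⟩)), Subtype.ext ?_⟩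
      · refine (pi_norm_le_iff_of_nonneg zero_le_one).2 fun i => ?_
        rw [Real.norm_of_nonneg (nonneg_of_mem_coneSpace hp i)]
        exact h1 i
      · change dilate (‖p.1‖ / ‖(realizationCoord x).1‖) (realizationCoord x) = p
        have hn : ‖p.1‖ = (∑ i, p.1 i) * ‖(realizationCoord x).1‖ := by
          rw [← Real.norm_of_nonneg (sum_pos_of_mem_coneSpace hp h).le, ← norm_smul,
            ← dilate_fst, hx]
        rw [hn, mul_div_cancel_right₀ _ (norm_realizationCoord_pos x).ne', hx]

/-- The cone over the realization is the cubical cone. -/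
noncomputable def coneHomeomorph : TopologicalCone (Realization S) ≃ₜ cubicalCone S := by
  have : CompactSpace (TopologicalCone (Realization S)) := inferInstanceAs (CompactSpace (Quot _))
  exact Continuous.homeoOfEquivCompactToT2 (f := Equiv.ofBijective _ bijective_coneMap)
    (continuous_quot_lift _ continuous_coneMapAux)

end Cone

/-! ### The infinite cone over a sphere -/

section RadialHomeomorphism

open Filter

variable {S : Type*} [PartialOrder S] [OrderBot S] [Finite S] [IsSimplicialPoset S]

/-- The radial projection from the complement of the apex to the realization. -/
noncomputable def direction (p : {p // p ∈ coneSpace S ∧ p ≠ apex S}) : Realization S :=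
  (exists_dilate_eq p.2.1 p.2.2).choose

theorem dilate_direction (p : {p // p ∈ coneSpace S ∧ p ≠ apex S}) :
    dilate (∑ i, p.1.1 i) (realizationCoord (direction p)) = p.1 :=
  (exists_dilate_eq p.2.1 p.2.2).choose_spec.1

theorem realizationCoord_direction (p : {p // p ∈ coneSpace S ∧ p ≠ apex S}) :
    realizationCoord (direction p) = dilate (∑ i, p.1.1 i)⁻¹ p.1 :=
  (exists_dilate_eq p.2.1 p.2.2).choose_spec.2

theorem continuous_direction : Continuous (direction (S := S)) := by
  rw [isClosedEmbedding_realizationCoord.isEmbedding.continuous_iff]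
  have h : realizationCoord ∘ direction (S := S) = fun p => dilate (∑ i, p.1.1 i)⁻¹ p.1 :=
    funext realizationCoord_direction
  rw [h]
  refine continuous_dilate.comp (Continuous.prodMk ?_ continuous_subtype_val)
  exact Continuous.inv₀ (by fun_prop) fun p => (sum_pos_of_mem_coneSpace p.2.1 p.2.2).ne'

variable {F : Type*} [NormedAddCommGroup F] [NormedSpace ℝ F]

open Classical in
/-- The extension of a map from the realization to the unit sphere to a map of the cone to the
vector space, homogeneous in the total weight. -/
noncomputable def coneToVector (h : Realization S → Metric.sphere (0 : F) 1)
    (p : coneSpace S) : F :=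
  if hp : p.1 = apex S then 0 else (∑ i, p.1.1 i) • (h (direction ⟨p.1, p.2, hp⟩) : F)

theorem norm_coneToVector (h : Realization S → Metric.sphere (0 : F) 1) (p : coneSpace S) :
    ‖coneToVector h p‖ = ∑ i, p.1.1 i := by
  have hs : 0 ≤ ∑ i, p.1.1 i := Finset.sum_nonneg fun i _ => nonneg_of_mem_coneSpace p.2 i
  by_cases hp : p.1 = apex S
  · simp [coneToVector, hp, apex]
  · rw [coneToVector, dif_neg hp, norm_smul, norm_eq_of_mem_sphere, mul_one,
      Real.norm_of_nonneg hs]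

theorem continuous_coneToVector {h : Realization S → Metric.sphere (0 : F) 1}
    (hh : Continuous h) : Continuous (coneToVector h) := by
  have hsum : Continuous fun p : coneSpace S => ∑ i, p.1.1 i := by fun_prop
  refine continuous_iff_continuousAt.2 fun p => ?_
  by_cases hp : p.1 = apex S
  · have h0 : coneToVector h p = 0 := dif_pos hp
    rw [ContinuousAt, h0]
    refine squeeze_zero_norm (fun q => (norm_coneToVector h q).le) ?_
    convert hsum.tendsto p using 2
    simp [hp, apex]
  · have hopen : IsOpen {q : coneSpace S | q.1 ≠ apex S} :=
      isOpen_ne.preimage continuous_subtype_val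
    refine ContinuousOn.continuousAt ?_ (hopen.mem_nhds hp)
    rw [continuousOn_iff_continuous_domRestrict]
    have hr : Set.domRestrict {q : coneSpace S | q.1 ≠ apex S} (coneToVector h) = fun q =>
        (∑ i, q.1.1.1 i) • (h (direction ⟨q.1.1, q.1.2, q.2⟩) : F) :=
      funext fun q => dif_neg q.2
    rw [hr]
    refine (hsum.comp continuous_subtype_val).smul (continuous_subtype_val.comp (hh.comp
      (continuous_direction.comp (Continuous.subtype_mk ?_ _))))
    exact continuous_subtype_val.comp continuous_subtype_val

/-- The unit vector in the direction of a nonzero vector. -/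
noncomputable def unitVector (y : {y : F // y ≠ 0}) : Metric.sphere (0 : F) 1 :=
  ⟨‖y.1‖⁻¹ • y.1, by simp [norm_smul, y.2]⟩

theorem continuous_unitVector : Continuous (unitVector (F := F)) := by
  refine Continuous.subtype_mk (Continuous.smul ?_ continuous_subtype_val) _
  exact Continuous.inv₀ (by fun_prop) fun y => norm_ne_zero_iff.2 y.2

open Classical in
/-- The extension of a map from the unit sphere to the realization to a map of the vector space to
the cone, homogeneous in the norm. -/
noncomputable def vectorToCone (k : Metric.sphere (0 : F) 1 → Realization S) (y : F) :
    coneSpace S :=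
  if hy : y = 0 then ⟨apex S, apex_mem_coneSpace S⟩ else
    ⟨dilate ‖y‖ (realizationCoord (k (unitVector ⟨y, hy⟩))),
      dilate_mem_coneSpace (norm_nonneg y) (realizationCoord_mem _).2⟩

/-- Small dilates of the realization are uniformly close to the apex, since the realization is
compact. -/
theorem eventually_dilate_realizationCoord_mem {O : Set ((Vertex S → ℝ) × (S → ℝ))}
    (hO : O ∈ 𝓝 (apex S)) :
    ∀ᶠ t in 𝓝 (0 : ℝ), ∀ x : Realization S, dilate t (realizationCoord x) ∈ O := by
  have key := (isCompact_univ (X := Realization S)).eventually_forall_of_forall_eventually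
    (x₀ := (0 : ℝ)) (P := fun t x => dilate t (realizationCoord x) ∈ O) (fun x _ => by
      have hc : Continuous fun q : ℝ × Realization S => dilate q.1 (realizationCoord q.2) :=
        continuous_dilate.comp (continuous_fst.prodMk
          (isClosedEmbedding_realizationCoord.continuous.comp continuous_snd))
      refine hc.tendsto (0, x) ?_
      simpa [dilate_zero (realizationCoord_mem x).2] using hO)
  simpa using key

theorem continuous_vectorToCone {k : Metric.sphere (0 : F) 1 → Realization S}
    (hk : Continuous k) : Continuous (vectorToCone k) := by
  refine continuous_iff_continuousAt.2 fun y => ?_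
  by_cases hy : y = 0
  · subst hy
    have h0 : vectorToCone k 0 = ⟨apex S, apex_mem_coneSpace S⟩ := dif_pos rfl
    rw [ContinuousAt, h0, tendsto_subtype_rng]
    intro O hO
    have hn : Tendsto (fun y : F => ‖y‖) (𝓝 0) (𝓝 0) := tendsto_norm_zero
    rw [mem_map]
    filter_upwards [hn.eventually (eventually_dilate_realizationCoord_mem hO)] with y h
    by_cases hy : y = 0
    · simpa [vectorToCone, hy] using mem_of_mem_nhds hO
    · simpa [vectorToCone, hy] using h _
  · refine ContinuousOn.continuousAt (s := {y | y ≠ 0}) ?_ (isOpen_ne.mem_nhds hy)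
    rw [continuousOn_iff_continuous_domRestrict, continuous_induced_rng]
    have hr : Subtype.val ∘ Set.domRestrict {y : F | y ≠ 0} (vectorToCone k) = fun y =>
        dilate ‖y.1‖ (realizationCoord (k (unitVector y))) :=
      funext fun y => congrArg Subtype.val (dif_neg y.2)
    rw [hr]
    exact continuous_dilate.comp ((continuous_norm.comp continuous_subtype_val).prodMk
      (isClosedEmbedding_realizationCoord.continuous.comp (hk.comp continuous_unitVector)))

/-- If the realization is the unit sphere, then the infinite cone is the vector space. -/
noncomputable def coneSpaceHomeomorph (h : Realization S ≃ₜ Metric.sphere (0 : F) 1) :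
    coneSpace S ≃ₜ F where
  toFun := coneToVector h
  invFun := vectorToCone h.symm
  left_inv p := by
    by_cases hp : p.1 = apex S
    · rw [coneToVector, dif_pos hp, vectorToCone, dif_pos rfl]
      exact Subtype.ext hp.symm
    · have hs := sum_pos_of_mem_coneSpace p.2 hp
      have hn := norm_coneToVector h p
      have h0 : coneToVector h p ≠ 0 := norm_ne_zero_iff.1 (hn ▸ hs.ne')
      have hu : unitVector ⟨coneToVector h p, h0⟩ = h (direction ⟨p.1, p.2, hp⟩) := by
        refine Subtype.ext ?_
        change ‖coneToVector h p‖⁻¹ • coneToVector h p = _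
        rw [hn, coneToVector, dif_neg hp, inv_smul_smul₀ hs.ne']
      rw [vectorToCone, dif_neg h0]
      refine Subtype.ext ?_
      simp only [hu, hn, Homeomorph.symm_apply_apply]
      exact dilate_direction ⟨p.1, p.2, hp⟩
  right_inv y := by
    by_cases hy : y = 0
    · rw [vectorToCone, dif_pos hy, coneToVector, dif_pos rfl, hy]
    · have hn : ‖y‖ ≠ 0 := norm_ne_zero_iff.2 hy
      set x := h.symm (unitVector ⟨y, hy⟩) with hx
      have hv : (vectorToCone h.symm y).1 = dilate ‖y‖ (realizationCoord x) :=
        congrArg Subtype.val (dif_neg hy)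
      have hs : ∑ i, (vectorToCone h.symm y).1.1 i = ‖y‖ := by
        rw [hv, sum_dilate_realizationCoord]
      have hp : (vectorToCone h.symm y).1 ≠ apex S := by
        intro hp
        rw [hp] at hs
        exact hn (by simpa [apex] using hs.symm)
      have hd : direction ⟨_, (vectorToCone h.symm y).2, hp⟩ = x := by
        refine isClosedEmbedding_realizationCoord.injective ?_
        rw [realizationCoord_direction]
        simp only [hs]
        rw [hv, dilate_dilate, inv_mul_cancel₀ hn, dilate_one]
      rw [coneToVector, dif_neg hp, hd, hs, hx, h.apply_symm_apply]
      exact smul_inv_smul₀ hn y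
  continuous_toFun := continuous_coneToVector h.continuous
  continuous_invFun := continuous_vectorToCone h.symm.continuous

end RadialHomeomorphism

/-! ### The Cayley transform -/

section Cayley

/-- The Cayley transform that sends the unit disc without its boundary point `q` to the closed
upper half-plane. -/
noncomputable def cayley (q z : ℂ) : ℂ := Complex.I * (q + z) / (q - z)

/-- The inverse of the Cayley transform. -/
noncomputable def cayleyInv (q w : ℂ) : ℂ := q * (w - Complex.I) / (w + Complex.I)

/-- The factor by which the Cayley transform changes the distance to the boundary. -/
noncomputable def cayleyFactor (q z : ℂ) : ℝ := (1 + ‖z‖) / ‖q - z‖ ^ 2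

theorem cayleyFactor_nonneg (q z : ℂ) : 0 ≤ cayleyFactor q z := by
  unfold cayleyFactor; positivity

theorem cayleyFactor_ne_zero {q z : ℂ} (h : z ≠ q) : cayleyFactor q z ≠ 0 := by
  have h1 : 0 < ‖q - z‖ := norm_pos_iff.2 (sub_ne_zero.2 h.symm)
  unfold cayleyFactor; positivity

/-- The imaginary part of the Cayley transform is a positive multiple of the distance to the
boundary, so that the transform straightens the unit circle. -/
theorem cayley_im {q : ℂ} (hq : ‖q‖ = 1) (z : ℂ) :
    (cayley q z).im = cayleyFactor q z * (1 - ‖z‖) := by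
  have h1 : cayleyFactor q z * (1 - ‖z‖) = (1 - ‖z‖ ^ 2) / ‖q - z‖ ^ 2 := by
    unfold cayleyFactor; ring
  have h2 : q.re * q.re + q.im * q.im = 1 := by
    rw [← Complex.normSq_apply, ← Complex.sq_norm, hq, one_pow]
  rw [h1, cayley, Complex.sq_norm, Complex.sq_norm, Complex.div_im, ← sub_div]
  congr 1
  simp only [Complex.normSq_apply, Complex.mul_re, Complex.mul_im, Complex.I_re, Complex.I_im,
    Complex.add_re, Complex.add_im, Complex.sub_re, Complex.sub_im]
  linear_combination h2

theorem add_I_ne_zero {w : ℂ} (hw : 0 ≤ w.im) : w + Complex.I ≠ 0 := by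
  intro h
  have := congrArg Complex.im h
  simp only [Complex.add_im, Complex.I_im, Complex.zero_im] at this
  linarith

theorem cayleyInv_ne {q w : ℂ} (hq : q ≠ 0) (hw : w + Complex.I ≠ 0) : cayleyInv q w ≠ q := by
  intro h
  rw [cayleyInv, div_eq_iff hw] at h
  have h2 := mul_left_cancel₀ hq h
  have h3 := congrArg Complex.im h2
  simp only [Complex.add_im, Complex.sub_im, Complex.I_im] at h3
  linarith

theorem cayley_cayleyInv {q w : ℂ} (hq : q ≠ 0) (hw : w + Complex.I ≠ 0) :
    cayley q (cayleyInv q w) = w := by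
  have h := sub_ne_zero.2 (cayleyInv_ne hq hw).symm
  rw [cayley, div_eq_iff h, cayleyInv]
  field_simp
  ring

theorem cayleyInv_cayley {q z : ℂ} (hq : q ≠ 0) (h : z ≠ q) :
    cayleyInv q (cayley q z) = z := by
  have h1 := sub_ne_zero.2 h.symm
  have h2 : cayley q z + Complex.I = Complex.I * 2 * q / (q - z) := by
    rw [cayley]; field_simp; ring
  have h3 : cayley q z - Complex.I = Complex.I * 2 * z / (q - z) := by
    rw [cayley]; field_simp; ring
  have hI := Complex.I_ne_zero
  rw [cayleyInv, h2, h3]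
  field_simp

end Cayley

/-! ### Charts of the moment-angle complex -/

section Charts

variable {S : Type*} [PartialOrder S] [OrderBot S] [Finite S]

/-- The image of the moment-angle complex in a Euclidean space. -/
def momentAngleModel (S : Type*) [PartialOrder S] [OrderBot S] [Finite S] :
    Set ((Vertex S → ℂ) × (S → ℝ)) :=
  {x | (depth x.1, x.2) ∈ coneSpace S}

/-- The factors by which the coordinatewise Cayley transform rescales the weights. -/
noncomputable def cayleyFactors {V : Type*} (q z : V → ℂ) : V → ℝ :=
  fun i => cayleyFactor (q i) (z i)

/-- The coordinatewise Cayley transform from the moment-angle complex to the product of a vector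
space and the infinite cone: the real parts are free, the imaginary parts are weights. -/
noncomputable def cayleyChart (q : Vertex S → ℂ) (x : momentAngleModel S) :
    (Vertex S → ℝ) × coneSpace S :=
  (fun i => (cayley (q i) (x.1.1 i)).re,
    ⟨rescale (cayleyFactors q x.1.1) (depth x.1.1, x.1.2),
      rescale_mem_coneSpace (fun _ => cayleyFactor_nonneg _ _) x.2⟩)

/-- The polydisc point with given real and imaginary parts of the Cayley transforms. -/
noncomputable def cayleyPoint {V : Type*} (q : V → ℂ) (a u : V → ℝ) : V → ℂ :=
  fun i => cayleyInv (q i) (a i + u i * Complex.I)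

/-- The weights of the polydisc point with imaginary parts `u` are rescaled to `u` by the Cayley
factors. -/
theorem depth_cayleyPoint {V : Type*} {q : V → ℂ} (hq : ∀ i, ‖q i‖ = 1) (a : V → ℝ) {u : V → ℝ}
    (hu : ∀ i, 0 ≤ u i) :
    cayleyFactors q (cayleyPoint q a u) * depth (cayleyPoint q a u) = u := by
  ext i
  have hw : (a i + u i * Complex.I : ℂ).im = u i := by simp
  have hq0 : q i ≠ 0 := norm_ne_zero_iff.1 (by simp [hq i])
  have h := cayley_im (hq i) (cayleyPoint q a u i)
  rw [cayleyPoint, cayley_cayleyInv hq0 (add_I_ne_zero (hw.symm ▸ hu i)), hw] at h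
  exact h.symm

theorem cayleyPoint_ne {V : Type*} {q : V → ℂ} (hq : ∀ i, ‖q i‖ = 1) (a : V → ℝ) {u : V → ℝ}
    (hu : ∀ i, 0 ≤ u i) (i : V) : cayleyPoint q a u i ≠ q i := by
  have hw : (a i + u i * Complex.I : ℂ).im = u i := by simp
  exact cayleyInv_ne (norm_ne_zero_iff.1 (by simp [hq i])) (add_I_ne_zero (hw.symm ▸ hu i))

theorem inv_mul_cayleyFactors {V : Type*} {q z : V → ℂ} (h : ∀ i, z i ≠ q i) :
    (cayleyFactors q z)⁻¹ * cayleyFactors q z = 1 :=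
  funext fun i => inv_mul_cancel₀ (cayleyFactor_ne_zero (h i))

theorem rescale_cayleyPoint {q : Vertex S → ℂ} (hq : ∀ i, ‖q i‖ = 1) (a : Vertex S → ℝ)
    {p : (Vertex S → ℝ) × (S → ℝ)} (hp : p ∈ coneSpace S) :
    (rescale (cayleyFactors q (cayleyPoint q a p.1))⁻¹ p).1 = depth (cayleyPoint q a p.1) := by
  have hu := nonneg_of_mem_coneSpace hp
  change _ * p.1 = _
  nth_rewrite 2 [← depth_cayleyPoint hq a hu]
  rw [← mul_assoc, inv_mul_cayleyFactors (cayleyPoint_ne hq a hu), one_mul]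

/-- The inverse of the coordinatewise Cayley transform. -/
noncomputable def cayleyChartInv {q : Vertex S → ℂ} (hq : ∀ i, ‖q i‖ = 1)
    (y : (Vertex S → ℝ) × coneSpace S) : momentAngleModel S :=
  ⟨(cayleyPoint q y.1 y.2.1.1, (rescale (cayleyFactors q (cayleyPoint q y.1 y.2.1.1))⁻¹ y.2.1).2),
    by
      have h := rescale_mem_coneSpace (l := (cayleyFactors q (cayleyPoint q y.1 y.2.1.1))⁻¹)
        (fun i => inv_nonneg.2 (cayleyFactor_nonneg _ _)) y.2.2
      change (depth (cayleyPoint q y.1 y.2.1.1), _) ∈ coneSpace S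
      rwa [← rescale_cayleyPoint hq y.1 y.2.2]⟩

theorem continuousOn_cayley (q : ℂ) : ContinuousOn (cayley q) {z | z ≠ q} := by
  refine ContinuousOn.div (by fun_prop) (by fun_prop) fun z hz => sub_ne_zero.2 (Ne.symm hz)

theorem continuousOn_cayleyFactor (q : ℂ) : ContinuousOn (cayleyFactor q) {z | z ≠ q} := by
  refine ContinuousOn.div (by fun_prop) (by fun_prop) fun z hz => ?_
  exact pow_ne_zero 2 (norm_ne_zero_iff.2 (sub_ne_zero.2 (Ne.symm hz)))

theorem continuousOn_cayleyChart (q : Vertex S → ℂ) :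
    ContinuousOn (cayleyChart q) {x : momentAngleModel S | ∀ i, x.1.1 i ≠ q i} := by
  have hx : ∀ i, ContinuousOn (fun x : momentAngleModel S => x.1.1 i)
      {x : momentAngleModel S | ∀ i, x.1.1 i ≠ q i} := fun i => Continuous.continuousOn (by fun_prop)
  refine ContinuousOn.prodMk (continuousOn_pi.2 fun i => ?_) ?_
  · exact Complex.continuous_re.comp_continuousOn
      ((continuousOn_cayley (q i)).comp (hx i) fun x hx => hx i)
  · refine continuousOn_iff_continuous_domRestrict.2 (Continuous.subtype_mk ?_ _)
    refine continuous_rescale.comp (Continuous.prodMk (continuous_pi fun i => ?_) ?_)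
    · exact continuousOn_iff_continuous_domRestrict.1
        ((continuousOn_cayleyFactor (q i)).comp (hx i) fun x hx => hx i)
    · have := continuous_depth (V := Vertex S)
      fun_prop

theorem continuous_cayleyChartInv {q : Vertex S → ℂ} (hq : ∀ i, ‖q i‖ = 1) :
    Continuous (cayleyChartInv hq) := by
  have hz : Continuous fun y : (Vertex S → ℝ) × coneSpace S => cayleyPoint q y.1 y.2.1.1 := by
    refine continuous_pi fun i => Continuous.div₀ (by fun_prop) (by fun_prop) fun y => ?_
    refine add_I_ne_zero ?_
    simpa using nonneg_of_mem_coneSpace y.2.2 i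
  refine Continuous.subtype_mk (hz.prodMk (continuous_snd.comp (continuous_rescale.comp
    (Continuous.prodMk (continuous_pi fun i => ?_) (by fun_prop))))) _
  have hne := fun y : (Vertex S → ℝ) × coneSpace S =>
    cayleyPoint_ne hq y.1 (nonneg_of_mem_coneSpace y.2.2) i
  refine Continuous.inv₀ ?_ fun y => cayleyFactor_ne_zero (hne y)
  exact (continuousOn_cayleyFactor (q i)).comp_continuous ((continuous_apply i).comp hz) hne

/-- The coordinatewise Cayley transform as a homeomorphism from the open set where no coordinate
equals that of `q`. -/
noncomputable def cayleyHomeomorph {q : Vertex S → ℂ} (hq : ∀ i, ‖q i‖ = 1) :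
    OpenPartialHomeomorph (momentAngleModel S) ((Vertex S → ℝ) × coneSpace S) where
  toFun := cayleyChart q
  invFun := cayleyChartInv hq
  source := {x | ∀ i, x.1.1 i ≠ q i}
  target := Set.univ
  map_source' _ _ := trivial
  map_target' y _ := cayleyPoint_ne hq y.1 (nonneg_of_mem_coneSpace y.2.2)
  left_inv' x hx := by
    have hz : cayleyPoint q (cayleyChart q x).1 (cayleyChart q x).2.1.1 = x.1.1 := by
      ext i
      have hq0 : q i ≠ 0 := norm_ne_zero_iff.1 (by simp [hq i])
      have him : (cayleyChart q x).2.1.1 i = (cayley (q i) (x.1.1 i)).im :=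
        (cayley_im (hq i) _).symm
      rw [cayleyPoint, him]
      change cayleyInv (q i) ((cayley (q i) (x.1.1 i)).re + _) = _
      rw [Complex.re_add_im, cayleyInv_cayley hq0 (hx i)]
    refine Subtype.ext (Prod.ext hz ?_)
    change (rescale (cayleyFactors q (cayleyPoint q _ _))⁻¹ (cayleyChart q x).2.1).2 = x.1.2
    rw [hz]
    change (rescale _ (rescale _ _)).2 = _
    rw [rescale_rescale, inv_mul_cayleyFactors hx, rescale_one]
  right_inv' y _ := by
    have hu := nonneg_of_mem_coneSpace y.2.2
    refine Prod.ext (funext fun i => ?_) (Subtype.ext ?_)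
    · have hq0 : q i ≠ 0 := norm_ne_zero_iff.1 (by simp [hq i])
      change (cayley (q i) (cayleyInv (q i) (y.1 i + y.2.1.1 i * Complex.I))).re = y.1 i
      rw [cayley_cayleyInv hq0 (add_I_ne_zero (by simpa using hu i))]
      simp
    · change rescale (cayleyFactors q (cayleyPoint q y.1 y.2.1.1))
        (depth (cayleyPoint q y.1 y.2.1.1), _) = y.2.1
      rw [← rescale_cayleyPoint hq y.1 y.2.2]
      change rescale _ (rescale _ _) = _
      rw [rescale_rescale, mul_comm, inv_mul_cayleyFactors (cayleyPoint_ne hq y.1 hu), rescale_one]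
  open_source := by
    simp only [Set.ofPred_forall]
    exact isOpen_iInter_of_finite fun i => isOpen_ne_fun (by fun_prop) continuous_const
  open_target := isOpen_univ
  continuousOn_toFun := continuousOn_cayleyChart q
  continuousOn_invFun := (continuous_cayleyChartInv hq).continuousOn

variable [IsSimplicialPoset S]

/-- The moment-angle complex is homeomorphic to its image. -/
noncomputable def momentAngleHomeomorph : MomentAngle S ≃ₜ momentAngleModel S :=
  isClosedEmbedding_momentAngleCoord.isEmbedding.toHomeomorph.trans
    (Homeomorph.setCongr range_momentAngleCoord)

/-- Each coordinatewise Cayley chart identifies an open subset of the moment-angle complex with the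
product of `ℝ^m` and the infinite cone, which is `ℝ^n` when the realization is a sphere. -/
theorem isTopologicalManifold_momentAngle (n : ℕ)
    (h : Realization S ≃ₜ Metric.sphere (0 : EuclideanSpace ℝ (Fin n)) 1) :
    IsTopologicalManifold (Nat.card (Vertex S) + n) (MomentAngle S) := by
  classical
  let E : ((Vertex S → ℝ) × EuclideanSpace ℝ (Fin n)) ≃L[ℝ]
      EuclideanSpace ℝ (Fin (Nat.card (Vertex S) + n)) :=
    ContinuousLinearEquiv.ofFinrankEq (by simp)
  let Φ : ((Vertex S → ℝ) × coneSpace S) ≃ₜ EuclideanSpace ℝ (Fin (Nat.card (Vertex S) + n)) :=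
    ((Homeomorph.refl _).prodCongr (coneSpaceHomeomorph h)).trans E.toHomeomorph
  -- Each point avoids the pole `1` or the pole `-1` in each coordinate.
  have key : ∀ x : MomentAngle S, ∃ e : OpenPartialHomeomorph (MomentAngle S)
      (EuclideanSpace ℝ (Fin (Nat.card (Vertex S) + n))), x ∈ e.source := by
    intro x
    let z := (momentAngleHomeomorph x).1.1
    let q : Vertex S → ℂ := fun i => if z i = 1 then -1 else 1
    have hq : ∀ i, ‖q i‖ = 1 := fun i => by by_cases hi : z i = 1 <;> simp [q, hi]
    have hz : ∀ i, z i ≠ q i := fun i => by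
      by_cases hi : z i = 1
      · simp only [q, hi, if_true]
        norm_num
      · simp [q, hi]
    exact ⟨momentAngleHomeomorph.transOpenPartialHomeomorph
      ((cayleyHomeomorph hq).transHomeomorph Φ), hz⟩
  choose e he using key
  exact
    { t2 := inferInstance
      secondCountable := isClosedEmbedding_momentAngleCoord.isEmbedding.secondCountableTopology
      charts := ⟨{
        atlas := Set.range e
        chartAt := e
        mem_chart_source := he
        chart_mem_atlas := fun x => ⟨x, rfl⟩ }⟩ }

end Charts

end SimplicialPoset

open SimplicialPoset in
theorem mainTheorem11
    (S₁ : Type*) [PartialOrder S₁] [OrderBot S₁] [Finite S₁] [IsSimplicialPoset S₁]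
    (S₂ : Type*) [PartialOrder S₂] [OrderBot S₂] [Finite S₂] [IsSimplicialPoset S₂]
    (S : Type*) [PartialOrder S] [OrderBot S] [Finite S] [IsSimplicialPoset S] :
    Nonempty (MomentAngle (Join S₁ S₂) ≃ₜ MomentAngle S₁ × MomentAngle S₂) ∧
    Nonempty (MulAction.orbitRel.Quotient (Torus S) (MomentAngle S) ≃ₜ
      TopologicalCone (Realization S)) ∧
    (∀ n : ℕ, Nonempty (Realization S ≃ₜ Metric.sphere (0 : EuclideanSpace ℝ (Fin n)) 1) →
      IsTopologicalManifold (Nat.card (Vertex S) + n) (MomentAngle S)) :=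
  ⟨nonempty_homeomorph_join, ⟨orbitHomeomorph.trans coneHomeomorph.symm⟩,
    fun n ⟨h⟩ => isTopologicalManifold_momentAngle n h⟩
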